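/- A polytope $P\subseteq\mathbb R^d$ is called *smooth Fano* if all its vertices lie in $\mathbb Z^d$, the origin lies in its interior, and the vertices of every facet of $P$ form a basis of the lattice $\mathbb Z^d$. For polytopes $P\subseteq\mathbb R^a$ and $Q\subseteq\mathbb R^b$ with the origin in their interiors, the free sum is $$P\oplus Q=\operatorname{conv}\bigl(\{(x,0): x\in P\}\cup\{(0,y): y\in Q\}\bigr)\subseteq\mathbb R^{a+b}.$$ Let $P\subseteq\mathbb R^a$ be a smooth Fano polytope, let $Q\subseteq\mathbb R^b$ be a smooth Fano polytope that is a simplex, and let $v$ be a vertex of $Q$. Then $R:=P\oplus Q$ is a smooth Fano polytope. Moreover, let $v'\in\mathbb Z^{a+b}$ be any lattice point in the affine subspace $\mathbb R^a+v=\{(x,v):x\in\mathbb R^a\}$, and let $R'$ be the convex hull of $v'$ and all vertices of $R$ other than $(0,v)$. If replacing $(0,v)$ by $v'$ preserves the combinatorial type, i.e. if there is an isomorphism from the face lattice of $R$ to the face lattice of $R'$ which sends the face with vertex set $S$ to the face whose vertex set is obtained from $S$ by replacing $(0,v)$, if present, by $v'$, then $R'$ is again a smooth Fano polytope. -/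

import Mathlib

namespace SimplexSum

/-- A polytope in `ℝ^ι`: the convex hull of finitely many points. -/
def IsPolytope {ι : Type*} (P : Set (ι → ℝ)) : Prop :=
  ∃ V : Finset (ι → ℝ), P = convexHull ℝ (V : Set (ι → ℝ))

/-- The vertices of a polytope are its extreme points. -/
def vertices {ι : Type*} (P : Set (ι → ℝ)) : Set (ι → ℝ) :=
  Set.extremePoints ℝ P

/-- The points of the integer lattice `ℤ^ι` in `ℝ^ι`. -/
def IsLatticePoint {ι : Type*} (x : ι → ℝ) : Prop :=
  ∀ i, ∃ n : ℤ, x i = (n : ℝ)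

/-- The faces of `P` (with `∅` and `P` itself): the sets of maximisers over `P` of linear
functionals, and the empty set. They are ordered by inclusion. -/
abbrev Face {ι : Type*} (P : Set (ι → ℝ)) : Type _ :=
  {F : Set (ι → ℝ) // IsExposed ℝ P F}

/-- A facet is a maximal proper face. -/
def IsFacet {ι : Type*} (P F : Set (ι → ℝ)) : Prop :=
  IsExposed ℝ P F ∧ F ≠ P ∧ ∀ G : Set (ι → ℝ), IsExposed ℝ P G → F ⊆ G → G = F ∨ G = P

/-- `S` is (the underlying set of) a basis of the lattice `ℤ^ι`. -/
def IsLatticeBasis {ι : Type*} (S : Set (ι → ℝ)) : Prop :=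
  ∃ B : Module.Basis ι ℤ (ι → ℤ), S = Set.range (fun (i : ι) (j : ι) => ((B i j : ℤ) : ℝ))

/-- Smooth Fano polytopes: lattice polytopes with the origin in the interior (in particular
full dimensional) such that the vertices of each facet are a lattice basis. -/
structure IsSmoothFano {ι : Type*} (P : Set (ι → ℝ)) : Prop where
  isPolytope : IsPolytope P
  lattice : ∀ w ∈ vertices P, IsLatticePoint w
  zero_mem_interior : (0 : ι → ℝ) ∈ interior P
  smooth : ∀ F : Set (ι → ℝ), IsFacet P F → IsLatticeBasis (vertices F)

/-- A polytope is a simplex if its vertices are affinely independent. -/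
def IsSimplex {ι : Type*} (Q : Set (ι → ℝ)) : Prop :=
  IsPolytope Q ∧ AffineIndependent ℝ (fun w : vertices Q => (w : ι → ℝ))

/-- The free sum `P ⊕ Q ⊆ ℝ^ι × ℝ^κ`, where `(x, y)` is written `Sum.elim x y`. -/
def freeSum {ι κ : Type*} (P : Set (ι → ℝ)) (Q : Set (κ → ℝ)) : Set (ι ⊕ κ → ℝ) :=
  convexHull ℝ ((fun x : ι → ℝ => (Sum.elim x 0 : ι ⊕ κ → ℝ)) '' P ∪
    (fun y : κ → ℝ => (Sum.elim 0 y : ι ⊕ κ → ℝ)) '' Q)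

/-- The polytope obtained from `R` by replacing the vertex `v` by the point `v'`. -/
def replaceVertex {ι : Type*} (R : Set (ι → ℝ)) (v v' : ι → ℝ) : Set (ι → ℝ) :=
  convexHull ℝ ((vertices R \ {v}) ∪ {v'})

open Classical in
/-- The map on points that sends `v` to `v'` and fixes everything else. -/
noncomputable def relabel {ι : Type*} (v v' : ι → ℝ) : (ι → ℝ) → (ι → ℝ) :=
  Function.update id v v'

/-- `R` and `R'` have the same combinatorial type with their vertices matched by `φ`: there is an
isomorphism of face lattices that takes the face of `R` with vertex set `S` to the face of `R'`
with vertex set `φ '' S`. -/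
def SameCombinatorialType {ι : Type*} (φ : (ι → ℝ) → (ι → ℝ)) (R R' : Set (ι → ℝ)) : Prop :=
  ∃ Φ : Face R ≃o Face R', ∀ F : Face R, vertices (Φ F).1 = φ '' vertices F.1

end SimplexSum

namespace SimplexSum

open Set

/-! ### Polytopes, exposed faces and facets -/

section Polytopes

variable {ι : Type*}

/-! Every facet of `P ⊕ Q` is the free sum of a facet of `P` and a facet of `Q`
(`IsFacet.exists_eq_freeSum`), so its vertices are the union of a basis of `ℤ^a` and a basis of
`ℤ^b`, which is a basis of `ℤ^(a+b)`. Hence `R` is smooth Fano.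

For `R'`, the equivalence of combinatorial types shows that the vertices of each facet are the
relabelled vertices of a facet of `R`. As `v'` differs from `(0,v)` by a lattice vector of the first
summand, the relabelled set is the image of a lattice basis under a transvection, so again a basis
(`IsLatticeBasis.relabel_sum`).

The origin stays interior because a functional that is nonpositive on `R'` must vanish: first on
`ℝ^a`, where `P` controls it, and then on `ℝ^b`, since it no longer distinguishes `v'` from `(0,v)`
(`zero_mem_interior_replaceVertex`). -/

theorem IsPolytope.isCompact {P : Set (ι → ℝ)} (h : IsPolytope P) : IsCompact P := by
  obtain ⟨V, rfl⟩ := h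
  exact V.finite_toSet.isCompact_convexHull ℝ

theorem IsPolytope.convex {P : Set (ι → ℝ)} (h : IsPolytope P) : Convex ℝ P := by
  obtain ⟨V, rfl⟩ := h
  exact convex_convexHull ℝ _

theorem IsPolytope.finite_vertices {P : Set (ι → ℝ)} (h : IsPolytope P) :
    (vertices P).Finite := by
  obtain ⟨V, rfl⟩ := h
  exact V.finite_toSet.subset extremePoints_convexHull_subset

theorem convexHull_vertices_of_finite {P : Set (ι → ℝ)} (hc : IsCompact P) (hconv : Convex ℝ P)
    (hfin : (vertices P).Finite) : convexHull ℝ (vertices P) = P := by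
  rw [← (hfin.isCompact_convexHull ℝ).isClosed.closure_eq]
  exact closure_convexHull_extremePoints hc hconv

theorem IsPolytope.convexHull_vertices {P : Set (ι → ℝ)} (h : IsPolytope P) :
    convexHull ℝ (vertices P) = P :=
  convexHull_vertices_of_finite h.isCompact h.convex h.finite_vertices

theorem isPolytope_convexHull {S : Set (ι → ℝ)} (hS : S.Finite) :
    IsPolytope (convexHull ℝ S) :=
  ⟨hS.toFinset, by simp⟩

/-- A linear functional bounded on a set is bounded on its convex hull. -/
theorem apply_le_of_mem_convexHull {S : Set (ι → ℝ)} {l : (ι → ℝ) →L[ℝ] ℝ} {c : ℝ}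
    (h : ∀ x ∈ S, l x ≤ c) {x : ι → ℝ} (hx : x ∈ convexHull ℝ S) : l x ≤ c :=
  convexHull_min (t := {x | l x ≤ c}) h (convex_halfSpace_le l.toLinearMap.isLinear c) hx

/-- The face of `P` cut out by the supporting hyperplane `l = 1`. -/
def unitFace (P : Set (ι → ℝ)) (l : (ι → ℝ) →L[ℝ] ℝ) : Set (ι → ℝ) := {x ∈ P | l x = 1}

theorem isExposed_unitFace {P : Set (ι → ℝ)} {l : (ι → ℝ) →L[ℝ] ℝ} (hl : ∀ x ∈ P, l x ≤ 1) :
    IsExposed ℝ P (unitFace P l) := by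
  rintro ⟨z, hzP, hz⟩
  refine ⟨l, Set.ext fun x => ⟨fun hx => ⟨hx.1, fun y hy => ?_⟩, fun hx => ⟨hx.1, ?_⟩⟩⟩
  · rw [hx.2]; exact hl y hy
  · exact le_antisymm (hl x hx.1) (hz ▸ hx.2 z hzP)

theorem unitFace_ne {P : Set (ι → ℝ)} (h0 : 0 ∈ interior P) (l : (ι → ℝ) →L[ℝ] ℝ) :
    unitFace P l ≠ P := by
  intro h
  have : (0 : ι → ℝ) ∈ unitFace P l := h.symm ▸ interior_subset h0
  simpa using this.2

/-- Every facet of `R'` corresponds to a facet of `R` under an equivalence of combinatorial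
types. -/
theorem SameCombinatorialType.exists_isFacet {φ : (ι → ℝ) → (ι → ℝ)} {R R' : Set (ι → ℝ)}
    (h : SameCombinatorialType φ R R') {F' : Set (ι → ℝ)} (hF' : IsFacet R' F') :
    ∃ F, IsFacet R F ∧ vertices F' = φ '' vertices F := by
  obtain ⟨Φ, hΦ⟩ := h
  let T : Face R := ⟨R, IsExposed.refl R⟩
  let T' : Face R' := ⟨R', IsExposed.refl R'⟩
  have hT : ∀ G : Face R, G ≤ T := fun G => G.2.subset
  have hT' : ∀ G : Face R', G ≤ T' := fun G => G.2.subset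
  -- An order isomorphism matches the top faces, hence also the proper ones.
  have htop : Φ T = T' :=
    le_antisymm (hT' _) (by simpa using Φ.monotone (hT (Φ.symm T')))
  let G' : Face R' := ⟨F', hF'.1⟩
  refine ⟨(Φ.symm G').1, ⟨(Φ.symm G').2, fun heq => ?_, fun G hG hle => ?_⟩, ?_⟩
  · have h1 : Φ.symm G' = T := Subtype.ext heq
    have h2 : G' = T' := by rw [← htop, ← h1, Φ.apply_symm_apply]
    exact hF'.2.1 (congrArg Subtype.val h2)
  · have h1 : Φ.symm G' ≤ ⟨G, hG⟩ := hle
    have h2 : G' ≤ Φ ⟨G, hG⟩ := by simpa using Φ.monotone h1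
    rcases hF'.2.2 _ (Φ ⟨G, hG⟩).2 h2 with h3 | h3
    · have h4 : Φ ⟨G, hG⟩ = G' := Subtype.ext h3
      left
      rw [← h4, Φ.symm_apply_apply]
    · have h4 : Φ ⟨G, hG⟩ = Φ T := by rw [htop]; exact Subtype.ext h3
      exact Or.inr (congrArg Subtype.val (Φ.injective h4))
  · have := hΦ (Φ.symm G')
    rwa [Φ.apply_symm_apply] at this

end Polytopes

/-! ### The origin as an interior point, tested by linear functionals -/

section Interior

variable {ι : Type*} [Fintype ι]

theorem eq_zero_of_nonpos_of_zero_mem_interior {P : Set (ι → ℝ)} (h0 : 0 ∈ interior P)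
    {l : (ι → ℝ) →L[ℝ] ℝ} (hl : ∀ x ∈ P, l x ≤ 0) : l = 0 := by
  have hmax : IsLocalMax l 0 := by
    filter_upwards [mem_interior_iff_mem_nhds.1 h0] with x hx
    simpa using hl x hx
  simpa using hmax.hasFDerivAt_eq_zero l.hasFDerivAt

/-- The origin is interior to a convex set which lies in no closed half-space bounded by a
linear hyperplane. -/
theorem zero_mem_interior_of_forall_nonpos {P : Set (ι → ℝ)} (hP : Convex ℝ P)
    (hne : P.Nonempty) (h : ∀ l : (ι → ℝ) →L[ℝ] ℝ, (∀ x ∈ P, l x ≤ 0) → l = 0) :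
    0 ∈ interior P := by
  have hint : (interior P).Nonempty := by
    rw [hP.interior_nonempty_iff_affineSpan_eq_top]
    obtain ⟨p, hp⟩ := hne
    have hpS : p ∈ affineSpan ℝ P := subset_affineSpan ℝ P hp
    by_contra hS
    have hdir : (affineSpan ℝ P).direction < ⊤ := by
      rw [lt_top_iff_ne_top]
      intro hd
      exact hS ((AffineSubspace.direction_eq_top_iff_of_nonempty ⟨p, hpS⟩).1 hd)
    obtain ⟨f, hf0, hf⟩ := Submodule.exists_le_ker_of_lt_top _ hdir
    have hconst : ∀ x ∈ P, f x = f p := by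
      intro x hx
      have := hf (AffineSubspace.vsub_mem_direction (subset_affineSpan ℝ P hx) hpS)
      simpa [sub_eq_zero] using this
    refine hf0 ?_
    -- As `f` is constant on `P`, one of `f` and `-f` is nonpositive there.
    have key : LinearMap.toContinuousLinearMap f = 0 := by
      rcases le_total (f p) 0 with hle | hle
      · exact h _ fun x hx => by simpa [hconst x hx] using hle
      · rw [← neg_eq_zero]
        exact h _ fun x hx => by simpa [hconst x hx] using hle
    ext i
    exact DFunLike.congr_fun key _
  by_contra h0
  obtain ⟨f, hf⟩ := geometric_hahn_banach_open_point hP.interior isOpen_interior h0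
  -- Separation gives the sign on the interior only; `P` lies in the closure of its interior.
  have hle : ∀ x ∈ P, f x ≤ 0 := by
    intro x hx
    have hx' : x ∈ closure (interior P) := by
      rw [hP.closure_interior_eq_closure_of_nonempty_interior hint]
      exact subset_closure hx
    have hcl : IsClosed {x | f x ≤ 0} := isClosed_le f.continuous continuous_const
    exact closure_minimal (fun y hy => by simpa using (hf y hy).le) hcl hx'
  obtain ⟨y, hy⟩ := hint
  simpa [h f hle] using hf y hy

/-- Every proper face, including the empty one, is cut out by a hyperplane `l = 1`. -/
theorem exists_eq_unitFace {P F : Set (ι → ℝ)} (h0 : 0 ∈ interior P) (hF : IsExposed ℝ P F)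
    (hne : F ≠ P) : ∃ l : (ι → ℝ) →L[ℝ] ℝ, (∀ x ∈ P, l x ≤ 1) ∧ F = unitFace P l := by
  rcases F.eq_empty_or_nonempty with rfl | hFne
  · exact ⟨0, by simp, by simp [unitFace]⟩
  obtain ⟨l, hl⟩ := hF hFne
  obtain ⟨z, hz⟩ := hFne
  have hz' : z ∈ P ∧ ∀ y ∈ P, l y ≤ l z := by rw [hl] at hz; exact hz
  -- A maximum `≤ 0` would force `l = 0`, making the face all of `P`; a positive one can be scaled
  -- to `1`.
  have hpos : 0 < l z := by
    by_contra hneg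
    have hl0 := eq_zero_of_nonpos_of_zero_mem_interior h0
      fun x hx => (hz'.2 x hx).trans (not_lt.1 hneg)
    exact hne (by rw [hl, hl0]; simp)
  refine ⟨(l z)⁻¹ • l, fun x hx => ?_, ?_⟩
  · simpa [inv_mul_le_iff₀ hpos] using hz'.2 x hx
  · ext x
    rw [hl]
    simp only [unitFace, mem_ofPred_eq, smul_apply, smul_eq_mul,
      inv_mul_eq_one₀ hpos.ne']
    exact ⟨fun h => ⟨h.1, le_antisymm (h.2 z hz'.1) (hz'.2 x h.1)⟩,
      fun h => ⟨h.1, fun y hy => h.2 ▸ hz'.2 y hy⟩⟩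

end Interior

/-! ### Lattice bases -/

section LatticeBases

variable {ι κ : Type*}

theorem IsLatticeBasis.finite [Finite ι] {S : Set (ι → ℝ)} (hS : IsLatticeBasis S) : S.Finite := by
  obtain ⟨B, rfl⟩ := hS
  exact finite_range _

/-- The `i`-th dual coordinate is `1` on the `i`-th basis vector and `0` on the others, so no basis
vector lies in the hull of the rest. -/
theorem vertices_convexHull_of_isLatticeBasis [Fintype ι] {S : Set (ι → ℝ)}
    (hS : IsLatticeBasis S) : vertices (convexHull ℝ S) = S := by
  classical
  have hfin := hS.finite
  have hsub : vertices (convexHull ℝ S) ⊆ S := extremePoints_convexHull_subset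
  have hconv := (isPolytope_convexHull hfin).convexHull_vertices
  obtain ⟨B, rfl⟩ := hS
  refine hsub.antisymm ?_
  rintro _ ⟨i, rfl⟩
  by_contra hi
  -- The real extension of the integral functional `B.coord i`.
  let f : (ι → ℝ) →L[ℝ] ℝ :=
    ∑ j, ((B.coord i (Pi.single j 1) : ℤ) : ℝ) • ContinuousLinearMap.proj j
  have hf : ∀ k, f (fun j => ((B k j : ℤ) : ℝ)) = ((B.coord i (B k) : ℤ) : ℝ) := by
    intro k
    conv_rhs => rw [← Finset.univ_sum_single (B k)]
    rw [map_sum, Int.cast_sum]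
    simp only [f, sum_apply, smul_apply, ContinuousLinearMap.proj_apply, smul_eq_mul]
    refine Finset.sum_congr rfl fun j _ => ?_
    rw [show (Pi.single j (B k j) : ι → ℤ) = B k j • Pi.single j 1 by
      rw [← Pi.single_smul, smul_eq_mul, mul_one], map_smul, smul_eq_mul, Int.cast_mul, mul_comm]
  have hle : ∀ x ∈ vertices (convexHull ℝ (range fun (i j : ι) => ((B i j : ℤ) : ℝ))),
      f x ≤ 0 := by
    intro x hx
    obtain ⟨k, rfl⟩ := hsub hx
    have hk : k ≠ i := by rintro rfl; exact hi hx
    simp only [hf]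
    simp [Finsupp.single_eq_of_ne hk.symm]
  have := apply_le_of_mem_convexHull hle
    (hconv.symm ▸ subset_convexHull ℝ _ ⟨i, rfl⟩ :
      (fun j => ((B i j : ℤ) : ℝ)) ∈ _)
  rw [hf] at this
  simp at this
  linarith

theorem IsLatticeBasis.zero_notMem {S : Set (ι → ℝ)} (hS : IsLatticeBasis S) : 0 ∉ S := by
  obtain ⟨B, rfl⟩ := hS
  rintro ⟨i, hi⟩
  refine B.ne_zero i (funext fun j => ?_)
  simpa using congrFun hi j

/-- The lattice basis of `ℤ^(ι ⊕ κ)` assembled from bases of `ℤ^ι` and `ℤ^κ`. -/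
noncomputable def sumBasis (B : Module.Basis ι ℤ (ι → ℤ)) (C : Module.Basis κ ℤ (κ → ℤ)) :
    Module.Basis (ι ⊕ κ) ℤ (ι ⊕ κ → ℤ) :=
  (B.prod C).map (LinearEquiv.sumArrowLequivProdArrow ι κ ℤ ℤ).symm

@[simp] theorem sumBasis_inl (B : Module.Basis ι ℤ (ι → ℤ)) (C : Module.Basis κ ℤ (κ → ℤ))
    (i : ι) : sumBasis B C (Sum.inl i) = Sum.elim (B i) 0 := by
  ext (j | j) <;> simp [sumBasis]

@[simp] theorem sumBasis_inr (B : Module.Basis ι ℤ (ι → ℤ)) (C : Module.Basis κ ℤ (κ → ℤ))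
    (k : κ) : sumBasis B C (Sum.inr k) = Sum.elim (0 : ι → ℤ) (C k) := by
  ext (j | j) <;> simp [sumBasis]

theorem IsLatticeBasis.sum {S : Set (ι → ℝ)} {T : Set (κ → ℝ)} (hS : IsLatticeBasis S)
    (hT : IsLatticeBasis T) :
    IsLatticeBasis ((fun x : ι → ℝ => (Sum.elim x 0 : ι ⊕ κ → ℝ)) '' S ∪
      (fun y : κ → ℝ => (Sum.elim (0 : ι → ℝ) y : ι ⊕ κ → ℝ)) '' T) := by
  obtain ⟨B, rfl⟩ := hS
  obtain ⟨C, rfl⟩ := hT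
  refine ⟨sumBasis B C, ?_⟩
  rw [← range_comp, ← range_comp, ← Sum.elim_range]
  congr 1
  ext (i | i) (j | j) <;> simp

/-- Moving one vector of the second basis by a lattice vector of the first summand gives a
lattice basis again. -/
theorem IsLatticeBasis.relabel_sum {S : Set (ι → ℝ)} {T : Set (κ → ℝ)}
    (hS : IsLatticeBasis S) (hT : IsLatticeBasis T) {v : κ → ℝ} {v' : ι ⊕ κ → ℝ}
    (hlat : IsLatticePoint v') (hv' : ∀ j, v' (Sum.inr j) = v j) :
    IsLatticeBasis (relabel (Sum.elim (0 : ι → ℝ) v) v' ''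
      ((fun x : ι → ℝ => (Sum.elim x 0 : ι ⊕ κ → ℝ)) '' S ∪
        (fun y : κ → ℝ => (Sum.elim (0 : ι → ℝ) y : ι ⊕ κ → ℝ)) '' T)) := by
  classical
  set U : Set (ι ⊕ κ → ℝ) := (fun x : ι → ℝ => (Sum.elim x 0 : ι ⊕ κ → ℝ)) '' S ∪
    (fun y : κ → ℝ => (Sum.elim (0 : ι → ℝ) y : ι ⊕ κ → ℝ)) '' T with hU
  have hother : ∀ u : ι ⊕ κ → ℝ, u ≠ Sum.elim (0 : ι → ℝ) v → relabel (Sum.elim (0 : ι → ℝ) v) v' u = u :=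
    fun u hu => by simp [relabel, Function.update_of_ne hu]
  by_cases he : (Sum.elim (0 : ι → ℝ) v : ι ⊕ κ → ℝ) ∈ U
  swap
  · have : relabel (Sum.elim (0 : ι → ℝ) v) v' '' U = U := by
      conv_rhs => rw [← image_id U]
      exact image_congr fun u hu => hother u (by rintro rfl; exact he hu)
    rw [this]
    exact hS.sum hT
  have hS0 := hS.zero_notMem
  have hvT : v ∈ T := by
    rcases he with ⟨x, hx, hxe⟩ | ⟨y, hy, hye⟩
    · have : x = 0 := funext fun i => by simpa using congrFun hxe (Sum.inl i)
      exact absurd (this ▸ hx) hS0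
    · have : y = v := funext fun i => by simpa using congrFun hye (Sum.inr i)
      exact this ▸ hy
  obtain ⟨B, rfl⟩ := hS
  obtain ⟨C, rfl⟩ := hT
  obtain ⟨k₀, rfl⟩ := hvT
  choose n hn using hlat
  let c : Module.Dual ℤ (ι ⊕ κ → ℤ) := C.coord k₀ ∘ₗ LinearMap.funLeft ℤ ℤ Sum.inr
  have hc₁ : ∀ x : ι → ℤ, c (Sum.elim x 0) = 0 := fun x => map_zero (C.coord k₀)
  have hc₂ : ∀ y : κ → ℤ, c (Sum.elim (0 : ι → ℤ) y) = C.coord k₀ y := fun y => rfl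
  -- The map `x ↦ x + c x • (n ∘ Sum.inl, 0)`: invertible since `c` kills the first summand, it
  -- moves only the basis vector `(0, C k₀)`, sending it to `v'`.
  refine ⟨(sumBasis B C).map (LinearEquiv.transvection (hc₁ (n ∘ Sum.inl))), ?_⟩
  rw [hU, ← range_comp, ← range_comp, ← Sum.elim_range, ← range_comp]
  congr 1
  ext1 s
  rcases s with i | k
  · have hne : (Sum.elim (fun j => ((B i j : ℤ) : ℝ)) 0 : ι ⊕ κ → ℝ) ≠
        Sum.elim (0 : ι → ℝ) (fun j => ((C k₀ j : ℤ) : ℝ)) := by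
      intro h
      exact hS0 ⟨i, funext fun j => by simpa using congrFun h (Sum.inl j)⟩
    simp only [Function.comp_apply, Sum.elim_inl, hother _ hne]
    ext (j | j) <;> simp [LinearMap.transvection.apply, hc₁]
  · simp only [Function.comp_apply, Sum.elim_inr]
    by_cases hk : k = k₀
    · subst hk
      simp only [relabel, Function.update_self]
      ext (j | j)
      · simp [LinearMap.transvection.apply, hc₂, hn]
      · simp [LinearMap.transvection.apply, hc₂, hv']
    · have hne : (Sum.elim (0 : ι → ℝ) (fun j => ((C k j : ℤ) : ℝ)) : ι ⊕ κ → ℝ) ≠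
          Sum.elim (0 : ι → ℝ) (fun j => ((C k₀ j : ℤ) : ℝ)) := by
        intro h
        refine hk (C.injective (funext fun j => ?_))
        simpa using congrFun h (Sum.inr j)
      rw [hother _ hne]
      ext (j | j) <;> simp [LinearMap.transvection.apply, hc₂, Finsupp.single_eq_of_ne (Ne.symm hk)]

end LatticeBases

/-! ### Free sums and their facets -/

section FreeSum

variable {ι κ : Type*}

/-- The inclusion of the first summand. -/
def inlL (ι κ : Type*) : (ι → ℝ) →L[ℝ] (ι ⊕ κ → ℝ) :=
  ContinuousLinearMap.pi (Sum.elim (fun i => ContinuousLinearMap.proj i) fun _ => 0)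

/-- The inclusion of the second summand. -/
def inrL (ι κ : Type*) : (κ → ℝ) →L[ℝ] (ι ⊕ κ → ℝ) :=
  ContinuousLinearMap.pi (Sum.elim (fun _ => 0) fun k => ContinuousLinearMap.proj k)

/-- The projection to the first summand. -/
def fstL (ι κ : Type*) : (ι ⊕ κ → ℝ) →L[ℝ] (ι → ℝ) :=
  ContinuousLinearMap.pi fun i => ContinuousLinearMap.proj (Sum.inl i)

/-- The projection to the second summand. -/
def sndL (ι κ : Type*) : (ι ⊕ κ → ℝ) →L[ℝ] (κ → ℝ) :=
  ContinuousLinearMap.pi fun k => ContinuousLinearMap.proj (Sum.inr k)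

theorem inlL_apply (x : ι → ℝ) : inlL ι κ x = Sum.elim x 0 := by
  ext (i | i) <;> simp [inlL]

theorem inrL_apply (y : κ → ℝ) : inrL ι κ y = Sum.elim (0 : ι → ℝ) y := by
  ext (i | i) <;> simp [inrL]

@[simp] theorem fstL_inlL (x : ι → ℝ) : fstL ι κ (inlL ι κ x) = x := by
  ext; simp [fstL, inlL]

@[simp] theorem fstL_inrL (y : κ → ℝ) : fstL ι κ (inrL ι κ y) = 0 := by
  ext; simp [fstL, inrL]

@[simp] theorem sndL_inlL (x : ι → ℝ) : sndL ι κ (inlL ι κ x) = 0 := by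
  ext; simp [sndL, inlL]

@[simp] theorem sndL_inrL (y : κ → ℝ) : sndL ι κ (inrL ι κ y) = y := by
  ext; simp [sndL, inrL]

theorem inlL_fstL_add_inrL_sndL (z : ι ⊕ κ → ℝ) :
    inlL ι κ (fstL ι κ z) + inrL ι κ (sndL ι κ z) = z := by
  ext (i | i) <;> simp [inlL, inrL, fstL, sndL]

theorem image_sum_elim_union (P : Set (ι → ℝ)) (Q : Set (κ → ℝ)) :
    (fun x : ι → ℝ => (Sum.elim x 0 : ι ⊕ κ → ℝ)) '' P ∪
      (fun y : κ → ℝ => (Sum.elim (0 : ι → ℝ) y : ι ⊕ κ → ℝ)) '' Q = inlL ι κ '' P ∪ inrL ι κ '' Q := by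
  simp only [← inlL_apply, ← inrL_apply]

theorem freeSum_eq (P : Set (ι → ℝ)) (Q : Set (κ → ℝ)) :
    freeSum P Q = convexHull ℝ (inlL ι κ '' P ∪ inrL ι κ '' Q) := by
  rw [freeSum, image_sum_elim_union]

theorem inlL_mem_freeSum {P : Set (ι → ℝ)} (Q : Set (κ → ℝ)) {x : ι → ℝ} (hx : x ∈ P) :
    inlL ι κ x ∈ freeSum P Q := by
  rw [freeSum_eq]
  exact subset_convexHull ℝ _ (Or.inl (mem_image_of_mem _ hx))

theorem inrL_mem_freeSum (P : Set (ι → ℝ)) {Q : Set (κ → ℝ)} {y : κ → ℝ} (hy : y ∈ Q) :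
    inrL ι κ y ∈ freeSum P Q := by
  rw [freeSum_eq]
  exact subset_convexHull ℝ _ (Or.inr (mem_image_of_mem _ hy))

theorem freeSum_convexHull (S : Set (ι → ℝ)) (T : Set (κ → ℝ)) :
    freeSum (convexHull ℝ S) (convexHull ℝ T) =
      convexHull ℝ (inlL ι κ '' S ∪ inrL ι κ '' T) := by
  have h₁ := (inlL ι κ).toLinearMap.image_convexHull S
  have h₂ := (inrL ι κ).toLinearMap.image_convexHull T
  simp only [ContinuousLinearMap.coe_coe] at h₁ h₂
  rw [freeSum_eq, h₁, h₂, convexHull_convexHull_union_left, convexHull_convexHull_union_right]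

theorem IsPolytope.freeSum_eq_convexHull_vertices {P : Set (ι → ℝ)} {Q : Set (κ → ℝ)}
    (hP : IsPolytope P) (hQ : IsPolytope Q) :
    freeSum P Q = convexHull ℝ (inlL ι κ '' vertices P ∪ inrL ι κ '' vertices Q) := by
  rw [← freeSum_convexHull, hP.convexHull_vertices, hQ.convexHull_vertices]

theorem IsPolytope.freeSum {P : Set (ι → ℝ)} {Q : Set (κ → ℝ)}
    (hP : IsPolytope P) (hQ : IsPolytope Q) : IsPolytope (freeSum P Q) := by
  rw [hP.freeSum_eq_convexHull_vertices hQ]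
  exact isPolytope_convexHull
    ((hP.finite_vertices.image _).union (hQ.finite_vertices.image _))

theorem IsPolytope.vertices_freeSum_subset {P : Set (ι → ℝ)} {Q : Set (κ → ℝ)}
    (hP : IsPolytope P) (hQ : IsPolytope Q) :
    vertices (SimplexSum.freeSum P Q) ⊆ inlL ι κ '' vertices P ∪ inrL ι κ '' vertices Q := by
  rw [hP.freeSum_eq_convexHull_vertices hQ]
  exact extremePoints_convexHull_subset

theorem IsLatticePoint.inlL {x : ι → ℝ} (hx : IsLatticePoint x) :
    IsLatticePoint (inlL ι κ x) := by
  rw [inlL_apply]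
  rintro (i | i)
  · exact hx i
  · exact ⟨0, by simp⟩

theorem IsLatticePoint.inrL {y : κ → ℝ} (hy : IsLatticePoint y) :
    IsLatticePoint (inrL ι κ y) := by
  rw [inrL_apply]
  rintro (i | i)
  · exact ⟨0, by simp⟩
  · exact hy i

theorem apply_le_of_mem_freeSum {P : Set (ι → ℝ)} {Q : Set (κ → ℝ)}
    {l : (ι ⊕ κ → ℝ) →L[ℝ] ℝ} {c : ℝ} (hP : ∀ x ∈ P, l (inlL ι κ x) ≤ c)
    (hQ : ∀ y ∈ Q, l (inrL ι κ y) ≤ c) {z : ι ⊕ κ → ℝ} (hz : z ∈ freeSum P Q) : l z ≤ c := by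
  rw [freeSum_eq] at hz
  refine apply_le_of_mem_convexHull ?_ hz
  rintro _ (⟨x, hx, rfl⟩ | ⟨y, hy, rfl⟩)
  exacts [hP x hx, hQ y hy]

theorem eq_zero_of_comp_eq_zero {l : (ι ⊕ κ → ℝ) →L[ℝ] ℝ} (h₁ : l ∘L inlL ι κ = 0)
    (h₂ : l ∘L inrL ι κ = 0) : l = 0 := by
  refine ContinuousLinearMap.ext fun z => ?_
  have e₁ := DFunLike.congr_fun h₁ (fstL ι κ z)
  have e₂ := DFunLike.congr_fun h₂ (sndL ι κ z)
  simp only [ContinuousLinearMap.comp_apply, zero_apply] at e₁ e₂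
  rw [← inlL_fstL_add_inrL_sndL z, map_add, e₁, e₂]
  simp

theorem freeSum_mono {P P' : Set (ι → ℝ)} {Q Q' : Set (κ → ℝ)} (hP : P ⊆ P') (hQ : Q ⊆ Q') :
    freeSum P Q ⊆ freeSum P' Q' :=
  convexHull_mono (union_subset_union (image_mono hP) (image_mono hQ))

/-- A point of the free sum lies on a segment from `P` to `Q`. Since `l ≤ 1` at both ends, `l = 1`
at the point forces `l = 1` at each end of positive weight. -/
theorem unitFace_freeSum {P : Set (ι → ℝ)} {Q : Set (κ → ℝ)} (hP : Convex ℝ P)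
    (hQ : Convex ℝ Q) (hPne : P.Nonempty) (hQne : Q.Nonempty) {l : (ι ⊕ κ → ℝ) →L[ℝ] ℝ}
    (hl : ∀ z ∈ freeSum P Q, l z ≤ 1) :
    unitFace (freeSum P Q) l =
      freeSum (unitFace P (l ∘L inlL ι κ)) (unitFace Q (l ∘L inrL ι κ)) := by
  apply Subset.antisymm
  · rintro z ⟨hz, hz1⟩
    have hP' : Convex ℝ (inlL ι κ '' P) := hP.is_linear_image (inlL ι κ).toLinearMap.isLinear
    have hQ' : Convex ℝ (inrL ι κ '' Q) := hQ.is_linear_image (inrL ι κ).toLinearMap.isLinear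
    rw [freeSum_eq, convexHull_union (hPne.image _) (hQne.image _), hP'.convexHull_eq,
      hQ'.convexHull_eq, mem_convexJoin] at hz
    obtain ⟨_, ⟨x, hx, rfl⟩, _, ⟨y, hy, rfl⟩, s, t, hs, ht, hst, rfl⟩ := hz
    have hx1 := hl _ (inlL_mem_freeSum Q hx)
    have hy1 := hl _ (inrL_mem_freeSum P hy)
    rw [map_add, map_smul, map_smul, smul_eq_mul, smul_eq_mul] at hz1
    rcases hs.eq_or_lt with rfl | hs
    · obtain rfl : t = 1 := by linarith
      rw [zero_smul, zero_add, one_smul]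
      exact inrL_mem_freeSum _ ⟨hy, by simpa using hz1⟩
    rcases ht.eq_or_lt with rfl | ht
    · obtain rfl : s = 1 := by linarith
      rw [zero_smul, add_zero, one_smul]
      exact inlL_mem_freeSum _ ⟨hx, by simpa using hz1⟩
    have hx2 : l (inlL ι κ x) = 1 := by nlinarith
    have hy2 : l (inrL ι κ y) = 1 := by nlinarith
    have hxF : x ∈ unitFace P (l ∘L inlL ι κ) := ⟨hx, hx2⟩
    have hyF : y ∈ unitFace Q (l ∘L inrL ι κ) := ⟨hy, hy2⟩
    exact convex_convexHull ℝ _ (inlL_mem_freeSum _ hxF) (inrL_mem_freeSum _ hyF)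
      hs.le ht.le hst
  · have hc : Convex ℝ (unitFace (freeSum P Q) l) :=
      (isExposed_unitFace hl).convex (convex_convexHull ℝ _)
    rw [freeSum_eq (unitFace P _)]
    refine convexHull_min ?_ hc
    rintro _ (⟨x, hx, rfl⟩ | ⟨y, hy, rfl⟩)
    · exact ⟨inlL_mem_freeSum Q hx.1, hx.2⟩
    · exact ⟨inrL_mem_freeSum P hy.1, hy.2⟩

variable [Fintype ι] [Fintype κ]

theorem zero_mem_interior_freeSum {P : Set (ι → ℝ)} {Q : Set (κ → ℝ)}
    (hP : 0 ∈ interior P) (hQ : 0 ∈ interior Q) : 0 ∈ interior (freeSum P Q) := by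
  refine zero_mem_interior_of_forall_nonpos (convex_convexHull ℝ _)
    ⟨_, inlL_mem_freeSum Q (interior_subset hP)⟩ fun l hl => eq_zero_of_comp_eq_zero ?_ ?_
  · exact eq_zero_of_nonpos_of_zero_mem_interior hP fun x hx => hl _ (inlL_mem_freeSum Q hx)
  · exact eq_zero_of_nonpos_of_zero_mem_interior hQ fun y hy => hl _ (inrL_mem_freeSum P hy)

/-- Every proper face is a `unitFace`, so maximality need only be tested against functionals bounded
by `1`. -/
theorem isFacet_unitFace_iff {P : Set (ι → ℝ)} (h0 : 0 ∈ interior P) {l : (ι → ℝ) →L[ℝ] ℝ}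
    (hl : ∀ x ∈ P, l x ≤ 1) : IsFacet P (unitFace P l) ↔ ∀ m : (ι → ℝ) →L[ℝ] ℝ,
      (∀ x ∈ P, m x ≤ 1) → unitFace P l ⊆ unitFace P m → unitFace P m = unitFace P l := by
  refine ⟨fun h m hm hlm => ?_, fun h => ⟨isExposed_unitFace hl, unitFace_ne h0 l, ?_⟩⟩
  · exact (h.2.2 _ (isExposed_unitFace hm) hlm).resolve_right (unitFace_ne h0 m)
  · intro G hG hlG
    by_cases hGP : G = P
    · exact Or.inr hGP
    obtain ⟨m, hm, rfl⟩ := exists_eq_unitFace h0 hG hGP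
    exact Or.inl (h m hm hlG)

/-- The facets of a free sum are free sums of facets. -/
theorem IsFacet.exists_eq_freeSum {P : Set (ι → ℝ)} {Q : Set (κ → ℝ)} (hP : Convex ℝ P)
    (hQ : Convex ℝ Q) (hP0 : 0 ∈ interior P) (hQ0 : 0 ∈ interior Q) {F : Set (ι ⊕ κ → ℝ)}
    (hF : IsFacet (freeSum P Q) F) :
    ∃ G H, IsFacet P G ∧ IsFacet Q H ∧ F = freeSum G H := by
  have h0 := zero_mem_interior_freeSum hP0 hQ0
  have hface := @unitFace_freeSum _ _ P Q hP hQ ⟨0, interior_subset hP0⟩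
    ⟨0, interior_subset hQ0⟩
  obtain ⟨l, hl, rfl⟩ := exists_eq_unitFace h0 hF.1 hF.2.1
  have hl₁ : ∀ x ∈ P, (l ∘L inlL ι κ) x ≤ 1 := fun x hx => hl _ (inlL_mem_freeSum Q hx)
  have hl₂ : ∀ y ∈ Q, (l ∘L inrL ι κ) y ≤ 1 := fun y hy => hl _ (inrL_mem_freeSum P hy)
  have hmax := (isFacet_unitFace_iff h0 hl).1 hF
  -- Replacing the two components of `l` by `m₁` and `m₂` cannot enlarge the facet.
  have key : ∀ (m₁ : (ι → ℝ) →L[ℝ] ℝ) (m₂ : (κ → ℝ) →L[ℝ] ℝ), (∀ x ∈ P, m₁ x ≤ 1) →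
      (∀ y ∈ Q, m₂ y ≤ 1) → unitFace P (l ∘L inlL ι κ) ⊆ unitFace P m₁ →
      unitFace Q (l ∘L inrL ι κ) ⊆ unitFace Q m₂ →
      unitFace (freeSum P Q) (m₁ ∘L fstL ι κ + m₂ ∘L sndL ι κ) = unitFace (freeSum P Q) l := by
    intro m₁ m₂ hm₁ hm₂ hs₁ hs₂
    have hm : ∀ z ∈ freeSum P Q, (m₁ ∘L fstL ι κ + m₂ ∘L sndL ι κ) z ≤ 1 := fun z hz =>
      apply_le_of_mem_freeSum (by simpa using hm₁) (by simpa using hm₂) hz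
    refine hmax _ hm ?_
    rw [hface hl, hface hm]
    refine freeSum_mono (hs₁.trans ?_) (hs₂.trans ?_)
    · exact fun x hx => ⟨hx.1, by simpa using hx.2⟩
    · exact fun y hy => ⟨hy.1, by simpa using hy.2⟩
  refine ⟨_, _, (isFacet_unitFace_iff hP0 hl₁).2 fun m hm hs => ?_,
    (isFacet_unitFace_iff hQ0 hl₂).2 fun m hm hs => ?_, hface hl⟩
  · refine Subset.antisymm (fun x hx => ⟨hx.1, ?_⟩) hs
    have : inlL ι κ x ∈ unitFace (freeSum P Q) (m ∘L fstL ι κ + (l ∘L inrL ι κ) ∘L sndL ι κ) :=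
      ⟨inlL_mem_freeSum Q hx.1, by simpa using hx.2⟩
    rw [key m _ hm hl₂ hs Subset.rfl] at this
    exact this.2
  · refine Subset.antisymm (fun y hy => ⟨hy.1, ?_⟩) hs
    have : inrL ι κ y ∈ unitFace (freeSum P Q) ((l ∘L inlL ι κ) ∘L fstL ι κ + m ∘L sndL ι κ) :=
      ⟨inrL_mem_freeSum P hy.1, by simpa using hy.2⟩
    rw [key _ m hl₁ hm Subset.rfl hs] at this
    exact this.2

theorem IsSmoothFano.convexHull_vertices_facet {P F : Set (ι → ℝ)} (hP : IsSmoothFano P)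
    (hF : IsFacet P F) : convexHull ℝ (vertices F) = F :=
  convexHull_vertices_of_finite (hF.1.isCompact hP.isPolytope.isCompact)
    (hF.1.convex hP.isPolytope.convex) (hP.smooth F hF).finite

/-- The vertices of a facet of a free sum of smooth Fano polytopes are those of a facet of
each summand. -/
theorem IsSmoothFano.exists_vertices_facet_freeSum {P : Set (ι → ℝ)} {Q : Set (κ → ℝ)}
    (hP : IsSmoothFano P) (hQ : IsSmoothFano Q) {F : Set (ι ⊕ κ → ℝ)}
    (hF : IsFacet (SimplexSum.freeSum P Q) F) :
    ∃ S T, IsLatticeBasis S ∧ IsLatticeBasis T ∧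
      vertices F = (fun x : ι → ℝ => (Sum.elim x 0 : ι ⊕ κ → ℝ)) '' S ∪
        (fun y : κ → ℝ => (Sum.elim (0 : ι → ℝ) y : ι ⊕ κ → ℝ)) '' T := by
  obtain ⟨G, H, hG, hH, rfl⟩ := hF.exists_eq_freeSum hP.isPolytope.convex hQ.isPolytope.convex
    hP.zero_mem_interior hQ.zero_mem_interior
  refine ⟨vertices G, vertices H, hP.smooth G hG, hQ.smooth H hH, ?_⟩
  conv_lhs => rw [← hP.convexHull_vertices_facet hG, ← hQ.convexHull_vertices_facet hH,
    freeSum_convexHull, ← image_sum_elim_union]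
  exact vertices_convexHull_of_isLatticeBasis ((hP.smooth G hG).sum (hQ.smooth H hH))

theorem IsSmoothFano.freeSum {P : Set (ι → ℝ)} {Q : Set (κ → ℝ)}
    (hP : IsSmoothFano P) (hQ : IsSmoothFano Q) : IsSmoothFano (freeSum P Q) where
  isPolytope := hP.isPolytope.freeSum hQ.isPolytope
  lattice w hw := by
    rcases hP.isPolytope.vertices_freeSum_subset hQ.isPolytope hw with
      ⟨x, hx, rfl⟩ | ⟨y, hy, rfl⟩
    exacts [(hP.lattice x hx).inlL, (hQ.lattice y hy).inrL]
  zero_mem_interior := zero_mem_interior_freeSum hP.zero_mem_interior hQ.zero_mem_interior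
  smooth F hF := by
    obtain ⟨S, T, hS, hT, h⟩ := hP.exists_vertices_facet_freeSum hQ hF
    rw [h]
    exact hS.sum hT

end FreeSum

/-! ### The origin after replacing a vertex -/

section ReplaceVertex

variable {ι κ : Type*} [Fintype ι] [Fintype κ]

theorem zero_mem_interior_replaceVertex {P : Set (ι → ℝ)} {Q : Set (κ → ℝ)}
    (hP : IsSmoothFano P) (hQ : IsSmoothFano Q) {v : κ → ℝ} {v' : ι ⊕ κ → ℝ}
    (hv' : ∀ j, v' (Sum.inr j) = v j) :
    0 ∈ interior (replaceVertex (freeSum P Q) (Sum.elim (0 : ι → ℝ) v) v') := by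
  have hpoly := hP.isPolytope.freeSum hQ.isPolytope
  have hsub := hP.isPolytope.vertices_freeSum_subset hQ.isPolytope
  refine zero_mem_interior_of_forall_nonpos (convex_convexHull ℝ _)
    ⟨v', subset_convexHull ℝ _ (Or.inr rfl)⟩ fun l hl => ?_
  have hold : ∀ z ∈ vertices (freeSum P Q), z ≠ inrL ι κ v → l z ≤ 0 := fun z hz hne =>
    hl z (subset_convexHull ℝ _ (Or.inl ⟨hz, by simpa [inrL_apply] using hne⟩))
  have hfst : l ∘L inlL ι κ = 0 := by
    refine eq_zero_of_nonpos_of_zero_mem_interior hP.zero_mem_interior fun x hx => ?_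
    have hx' := inlL_mem_freeSum Q hx
    rw [← hpoly.convexHull_vertices] at hx'
    have := apply_le_of_mem_convexHull (l := l ∘L inlL ι κ ∘L fstL ι κ) (c := 0) ?_ hx'
    · simpa using this
    intro z hz
    rcases hsub hz with ⟨p, -, rfl⟩ | ⟨q, -, rfl⟩
    -- The two copies meet only at the origin, where `l` vanishes.
    · by_cases he : inlL ι κ p = inrL ι κ v
      · have hp : p = 0 := by simpa using congrArg (fstL ι κ) he
        simp [hp]
      · simpa using hold _ hz he
    · simp
  refine eq_zero_of_comp_eq_zero hfst ?_
  refine eq_zero_of_nonpos_of_zero_mem_interior hQ.zero_mem_interior fun y hy => ?_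
  have hy' := inrL_mem_freeSum P hy
  rw [← hpoly.convexHull_vertices] at hy'
  have := apply_le_of_mem_convexHull (l := l ∘L inrL ι κ ∘L sndL ι κ) (c := 0) ?_ hy'
  · simpa using this
  intro z hz
  rcases hsub hz with ⟨p, -, rfl⟩ | ⟨q, -, rfl⟩
  · simp
  · by_cases he : inrL ι κ q = inrL ι κ v
    -- Since `l` vanishes on the first summand, `l (0,v) = l v' ≤ 0`.
    · have hsnd : sndL ι κ v' = v := funext fun j => by simp [sndL, hv']
      have h1 := hl v' (subset_convexHull ℝ _ (Or.inr rfl))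
      have h2 := DFunLike.congr_fun hfst (fstL ι κ v')
      simp only [ContinuousLinearMap.comp_apply, zero_apply] at h2
      rw [← inlL_fstL_add_inrL_sndL v', map_add, h2, zero_add, hsnd, ← he] at h1
      simpa using h1
    · simpa using hold _ hz he

end ReplaceVertex

end SimplexSum

theorem mainTheorem2 (a b : ℕ) (P : Set (Fin a → ℝ)) (Q : Set (Fin b → ℝ))
    (hP : SimplexSum.IsSmoothFano P)
    (hQ : SimplexSum.IsSmoothFano Q) (hQs : SimplexSum.IsSimplex Q)
    (v : Fin b → ℝ) (hv : v ∈ SimplexSum.vertices Q) :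
    SimplexSum.IsSmoothFano (SimplexSum.freeSum P Q) ∧
    ∀ v' : Fin a ⊕ Fin b → ℝ, SimplexSum.IsLatticePoint v' →
      (∀ j : Fin b, v' (Sum.inr j) = v j) →
      SimplexSum.SameCombinatorialType (SimplexSum.relabel (Sum.elim 0 v) v')
        (SimplexSum.freeSum P Q)
        (SimplexSum.replaceVertex (SimplexSum.freeSum P Q) (Sum.elim 0 v) v') →
      SimplexSum.IsSmoothFano
        (SimplexSum.replaceVertex (SimplexSum.freeSum P Q) (Sum.elim 0 v) v') := by
  have hR := hP.freeSum hQ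
  refine ⟨hR, fun v' hlat hv' hcomb => ⟨?_, fun w hw => ?_, ?_, fun F' hF' => ?_⟩⟩
  · exact SimplexSum.isPolytope_convexHull
      (hR.isPolytope.finite_vertices.sdiff.union (Set.finite_singleton v'))
  · rcases extremePoints_convexHull_subset hw with h | rfl
    exacts [hR.lattice w h.1, hlat]
  · exact SimplexSum.zero_mem_interior_replaceVertex hP hQ hv'
  · obtain ⟨F, hF, hFv⟩ := hcomb.exists_isFacet hF'
    obtain ⟨S, T, hS, hT, h⟩ := hP.exists_vertices_facet_freeSum hQ hF
    rw [hFv, h]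
    exact hS.relabel_sum hT hlat hv'
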